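/- Let $H$ be a complex Hilbert space and $L(H)$ the algebra of bounded linear operators on $H$; $R(T)$ and $N(T)$ denote the range and nullspace of $T\in L(H)$. Let $W\in L(H)$ be positive (semidefinite). For a subspace $S\subseteq H$ let $S^{\perp_W}=\{x\in H:\langle Wx,y\rangle=0\ \text{for all } y\in S\}$. For a closed subspace $S$, the shorted operator $W_{/S}$ is the maximum, in the order induced by the cone of positive operators, of $\{X\in L(H): 0\le X\le W,\ R(X)\subseteq S^{\perp}\}$ (this maximum exists), and the pair $(W,S)$ is called compatible if there is $Q\in L(H)$ with $Q^2=Q$, $R(Q)=S$ and $WQ=Q^*W$. For $C,D\in L(H)$ write $C\stackrel{-}{\leq}D$ (minus order) if there are $P,Q\in L(H)$ with $P^2=P$, $Q^2=Q$, $C=PD$ and $C^*=QD^*$. **Proposition.** Let $A,B\in L(H)$ have closed ranges and suppose $N(B)=R(A)^{\perp_W}$. Then $W_{/R(A)}$ is a lower bound, with respect to $\stackrel{-}{\leq}$, of the set $$\{(AXB-I)^*W(AXB-I): X\in L(H)\}$$ if and only if the pair $(W,N(W_{/R(A)}))$ is compatible. In this case, if moreover $R(A)+R(A)^{\perp_W}$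 is closed, then $W_{/R(A)}$ is the infimum of that set with respect to $\stackrel{-}{\leq}$; that is, $W_{/R(A)}$ is a lower bound of it, and every lower bound $D\in L(H)$ of it satisfies $D\stackrel{-}{\leq}W_{/R(A)}$. -/

import Mathlib

namespace MinusOrder

variable {H : Type*} [NormedAddCommGroup H] [InnerProductSpace ℂ H] [CompleteSpace H]

/-- The minus order on bounded operators: `A ≤⁻ B` iff there are bounded (oblique) projections
`P`, `Q` such that `A = P B` and `A* = Q B*`. -/
def MinusLE (A B : H →L[ℂ] H) : Prop :=
  ∃ P Q : H →L[ℂ] H, IsIdempotentElem P ∧ IsIdempotentElem Q ∧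
    A = P * B ∧ ContinuousLinearMap.adjoint A = Q * ContinuousLinearMap.adjoint B

/-- `D` is a lower bound of the set `F` in the minus order. -/
def IsMinusLowerBound (F : Set (H →L[ℂ] H)) (D : H →L[ℂ] H) : Prop :=
  ∀ T ∈ F, MinusLE D T

/-- `D` is the infimum (greatest lower bound) of the set `F` in the minus order. -/
def IsMinusInf (F : Set (H →L[ℂ] H)) (D : H →L[ℂ] H) : Prop :=
  IsMinusLowerBound F D ∧ ∀ D' : H →L[ℂ] H, IsMinusLowerBound F D' → MinusLE D' D

/-- The pair `(W, S)` is compatible: there is a bounded projection `Q` with range `S` such that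
`W Q = Q* W`. -/
def Compatible (W : H →L[ℂ] H) (S : Submodule ℂ H) : Prop :=
  ∃ Q : H →L[ℂ] H, IsIdempotentElem Q ∧ LinearMap.range (Q : H →ₗ[ℂ] H) = S ∧
    W * Q = ContinuousLinearMap.adjoint Q * W

/-- The `W`-orthogonal companion `{x | ⟨W x, y⟩ = 0 for all y ∈ S}` of `S`. -/
def wOrth (W : H →L[ℂ] H) (S : Submodule ℂ H) : Submodule ℂ H where
  carrier := {x | ∀ y ∈ S, inner ℂ (W x) y = 0}
  zero_mem' := by
    intro y _
    simp
  add_mem' := by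
    intro a b ha hb y hy
    simp [ha y hy, hb y hy]
  smul_mem' := by
    intro c a ha y hy
    simp [ha y hy]

/-- The set of all bounded `X` with `0 ≤ X ≤ W` (order induced by the cone of positive operators)
and `R(X) ⊆ S^⊥`. -/
def shortedSet (W : H →L[ℂ] H) (S : Submodule ℂ H) : Set (H →L[ℂ] H) :=
  {X | 0 ≤ X ∧ X ≤ W ∧ LinearMap.range (X : H →ₗ[ℂ] H) ≤ Sᗮ}

theorem exists_isGreatest_shortedSet {W : H →L[ℂ] H} (hW : W.IsPositive) (S : Submodule ℂ H) :
    ∃ G, IsGreatest (shortedSet W S) G := by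
  classical
  have hW0 : 0 ≤ W := (ContinuousLinearMap.nonneg_iff_isPositive W).2 hW
  set T : H →L[ℂ] H := CFC.sqrt W with hT
  have hTT : T * T = W := CFC.sqrt_mul_sqrt_self W hW0
  have hTpos : T.IsPositive :=
    (ContinuousLinearMap.nonneg_iff_isPositive T).1 (CFC.sqrt_nonneg W)
  have hTsym : ∀ x y, inner ℂ (T x) y = inner ℂ x (T y) := hTpos.inner_left_eq_inner_right
  set R : Submodule ℂ H := S.map (T : H →ₗ[ℂ] H) with hR
  set P : H →L[ℂ] H := Rᗮ.starProjection with hP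
  have hPsym : ∀ x y, inner ℂ (P x) y = inner ℂ x (P y) := fun x y =>
    Submodule.inner_starProjection_left_eq_right Rᗮ x y
  have hPP : ∀ x, P (P x) = P x := fun x =>
    Submodule.starProjection_eq_self_iff.2 (Submodule.starProjection_apply_mem Rᗮ x)
  have hWT : ∀ x, W x = T (T x) := fun x => by rw [← hTT]; rfl
  have key : ∀ x, inner ℂ (T (P (T x))) x = ((‖P (T x)‖ ^ 2 : ℝ) : ℂ) := by
    intro x
    rw [hTsym, ← hPP, hPsym, inner_self_eq_norm_sq_to_K, hPP]
    simp
  have keyW : ∀ x, inner ℂ (W x) x = ((‖T x‖ ^ 2 : ℝ) : ℂ) := by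
    intro x
    rw [hWT, hTsym, inner_self_eq_norm_sq_to_K]
    simp
  refine ⟨T * P * T, ⟨?_, ?_, ?_⟩, ?_⟩
  · rw [ContinuousLinearMap.nonneg_iff_isPositive, ContinuousLinearMap.isPositive_iff_complex]
    intro x
    have : inner ℂ ((T * P * T) x) x = ((‖P (T x)‖ ^ 2 : ℝ) : ℂ) := key x
    rw [this]
    exact ⟨by rw [RCLike.re_eq_complex_re, Complex.ofReal_re], by rw [RCLike.re_eq_complex_re, Complex.ofReal_re]; positivity⟩
  · rw [ContinuousLinearMap.le_def, ContinuousLinearMap.isPositive_iff_complex]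
    intro x
    have : inner ℂ ((W - T * P * T) x) x = ((‖T x‖ ^ 2 - ‖P (T x)‖ ^ 2 : ℝ) : ℂ) := by
      have h1 : (W - T * P * T) x = W x - T (P (T x)) := rfl
      rw [h1, inner_sub_left, key, keyW]
      push_cast
      rfl
    rw [this]
    refine ⟨by rw [RCLike.re_eq_complex_re, Complex.ofReal_re], ?_⟩
    rw [RCLike.re_eq_complex_re, Complex.ofReal_re]
    have h2 : ‖P (T x)‖ ≤ ‖T x‖ := Submodule.norm_starProjection_apply_le Rᗮ (T x)
    nlinarith [norm_nonneg (P (T x)), norm_nonneg (T x)]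
  · rintro _ ⟨x, rfl⟩
    rw [Submodule.mem_orthogonal]
    intro s hs
    change inner ℂ s (T (P (T x))) = 0
    rw [← hTsym]
    exact (Submodule.mem_orthogonal R _).1 (Submodule.starProjection_apply_mem Rᗮ (T x)) _
      (Submodule.mem_map_of_mem hs)
  · rintro X ⟨hX0, hXW, hXr⟩
    have hXpos : X.IsPositive := (ContinuousLinearMap.nonneg_iff_isPositive X).1 hX0
    have hXsym : ∀ x y, inner ℂ (X x) y = inner ℂ x (X y) := hXpos.inner_left_eq_inner_right
    have hXS : ∀ s ∈ S, X s = 0 := by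
      intro s hs
      have h3 : inner ℂ s (X (X s)) = 0 :=
        (Submodule.mem_orthogonal S _).1 (hXr ⟨X s, rfl⟩) s hs
      rw [← hXsym] at h3
      exact inner_self_eq_zero.1 h3
    have hbound : ∀ v, ∀ s ∈ S, (inner ℂ (X v) v).re ≤ ‖T v - T s‖ ^ 2 := by
      intro v s hs
      have h4 : inner ℂ (X (v - s)) (v - s) = inner ℂ (X v) v := by
        rw [map_sub, hXS s hs, sub_zero, inner_sub_right, hXsym v s, hXS s hs]
        simp
      have h5 := (ContinuousLinearMap.le_def X W).1 hXW |>.re_inner_nonneg_left (v - s)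
      have h6 : (W - X) (v - s) = W (v - s) - X (v - s) := rfl
      rw [h6, inner_sub_left, h4, keyW, map_sub T, map_sub] at h5
      rw [RCLike.re_eq_complex_re, Complex.ofReal_re] at h5
      linarith
    have hmain : ∀ v, (inner ℂ (X v) v).re ≤ ‖P (T v)‖ ^ 2 := by
      intro v
      have hmem : T v - P (T v) ∈ R.topologicalClosure := by
        rw [← Submodule.orthogonal_orthogonal_eq_closure]
        exact Submodule.sub_starProjection_mem_orthogonal (K := Rᗮ) (T v)
      have hcl : IsClosed {w : H | (inner ℂ (X v) v).re ≤ ‖T v - w‖ ^ 2} :=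
        isClosed_le continuous_const (by fun_prop)
      have hsub : (R : Set H) ⊆ {w : H | (inner ℂ (X v) v).re ≤ ‖T v - w‖ ^ 2} := by
        rintro _ ⟨s, hs, rfl⟩
        exact hbound v s hs
      have h7 := closure_minimal hsub hcl hmem
      simpa using h7
    rw [ContinuousLinearMap.le_def, ContinuousLinearMap.isPositive_iff_complex]
    intro v
    have hXre : inner ℂ (X v) v = (((inner ℂ (X v) v).re : ℝ) : ℂ) :=
      ((ContinuousLinearMap.isPositive_iff_complex X).1 hXpos v).1.symm
    have h8 : inner ℂ ((T * P * T - X) v) v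
        = ((‖P (T v)‖ ^ 2 - (inner ℂ (X v) v).re : ℝ) : ℂ) := by
      have h9 : (T * P * T - X) v = T (P (T v)) - X v := rfl
      rw [h9, inner_sub_left, key, Complex.ofReal_sub, ← hXre]
    rw [h8]
    refine ⟨by rw [RCLike.re_eq_complex_re, Complex.ofReal_re], ?_⟩
    rw [RCLike.re_eq_complex_re, Complex.ofReal_re]
    linarith [hmain v]

/-- The shorted operator `W_{/S}`: the maximum of `{X | 0 ≤ X ≤ W, R(X) ⊆ S^⊥}` in the order
induced by the cone of positive operators. -/
noncomputable def shorted (W : H →L[ℂ] H) (hW : W.IsPositive) (S : Submodule ℂ H) : H →L[ℂ] H :=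
  (exists_isGreatest_shortedSet hW S).choose

theorem shorted_isGreatest (W : H →L[ℂ] H) (hW : W.IsPositive) (S : Submodule ℂ H) :
    IsGreatest (shortedSet W S) (shorted W hW S) :=
  (exists_isGreatest_shortedSet hW S).choose_spec

end MinusOrder

namespace MinusOrder

open ContinuousLinearMap

/-! Write S = R(A), N = S^{⊥_W} and G = W_{/S}. The operator G vanishes on S and agrees with W
exactly on N (`shorted_apply_eq_iff`), and compatibility of (W, N(G)) amounts to a bounded
projection Q onto N(G) with R(1 - Q) ⊆ N (`compatible_ker_shorted_iff`). The choice X = 0 puts W in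
the family, so a lower bound G satisfies G = PW, and Q is built from P*. Conversely, with Y = AXB,
the operator Z = (Y - 1)*W(Y - 1) agrees with G on N, because Y vanishes on N and WN ⊥ S. Hence G =
G(1 - Q) = Z(1 - Q), and taking adjoints gives G below Z. If S + N is closed, some Y = AXB satisfies
Ys - s ∈ N for s ∈ S, and its Z vanishes on S. A lower bound D lies below both W and this Z, so D
vanishes on S and then on N(G). The projections that place D below W therefore also place it below
G. -/

theorem isClosed_wOrth {H : Type*} [NormedAddCommGroup H] [InnerProductSpace ℂ H]
    (W : H →L[ℂ] H) (S : Submodule ℂ H) :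
    IsClosed (wOrth W S : Set H) := by
  have : (wOrth W S : Set H) = ⋂ y ∈ S, {x | inner ℂ (W x) y = 0} := by
    ext x
    simp [wOrth]
  rw [this]
  exact isClosed_biInter fun y _ => isClosed_eq (by fun_prop) continuous_const

variable {H : Type*} [NormedAddCommGroup H] [InnerProductSpace ℂ H] [CompleteSpace H]

/-! ### Generalized inverses and oblique maps -/

/-- A bounded operator with closed range has a bounded generalized inverse. -/
theorem exists_generalizedInverse (A : H →L[ℂ] H)
    (hA : IsClosed (LinearMap.range (A : H →ₗ[ℂ] H) : Set H)) :
    ∃ A' : H →L[ℂ] H, ∀ x, A (A' (A x)) = A x := by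
  set R : Submodule ℂ H := LinearMap.range (A : H →ₗ[ℂ] H) with hR
  set K : Submodule ℂ H := LinearMap.ker (A : H →ₗ[ℂ] H) with hK
  have hKc : IsClosed (K : Set H) := ContinuousLinearMap.isClosed_ker A
  have : CompleteSpace R := hA.completeSpace_coe
  have : CompleteSpace K := hKc.completeSpace_coe
  -- Between N(A)^⊥ and R(A), both complete, A is a bounded bijection, so its inverse is bounded by
  -- the open mapping theorem.
  let f : Kᗮ →L[ℂ] R := (A.comp Kᗮ.subtypeL).codRestrict R fun x => ⟨x, rfl⟩
  have hinj : LinearMap.ker (f : Kᗮ →ₗ[ℂ] R) = ⊥ := by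
    rw [LinearMap.ker_eq_bot']
    rintro ⟨x, hx⟩ h
    have h1 : A x = 0 := congrArg Subtype.val h
    have h2 : inner ℂ x x = 0 := (Submodule.mem_orthogonal K x).1 hx x h1
    exact Subtype.ext (inner_self_eq_zero.1 h2)
  have hsurj : LinearMap.range (f : Kᗮ →ₗ[ℂ] R) = ⊤ := by
    rw [LinearMap.range_eq_top]
    rintro ⟨_, x, rfl⟩
    refine ⟨⟨x - K.starProjection x, Submodule.sub_starProjection_mem_orthogonal x⟩,
      Subtype.ext ?_⟩
    have h1 : A (K.starProjection x) = 0 := Submodule.starProjection_apply_mem K x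
    change A (x - K.starProjection x) = A x
    rw [map_sub, h1, sub_zero]
  let e := ContinuousLinearEquiv.ofBijective f hinj hsurj
  refine ⟨Kᗮ.subtypeL.comp ((e.symm : R →L[ℂ] Kᗮ).comp R.orthogonalProjectionOnto), fun x => ?_⟩
  have h1 : R.orthogonalProjectionOnto (A x) = ⟨A x, x, rfl⟩ :=
    Submodule.orthogonalProjectionOnto_mem_subspace_eq_self (K := R) ⟨A x, x, rfl⟩
  have h2 : f (e.symm ⟨A x, x, rfl⟩) = ⟨A x, x, rfl⟩ :=
    ContinuousLinearEquiv.ofBijective_apply_symm_apply f hinj hsurj _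
  change A (e.symm (R.orthogonalProjectionOnto (A x)) : H) = A x
  rw [h1]
  exact congrArg Subtype.val h2

/-- Every operator with range in `R(A)` and vanishing on `N(B)` has the form `A X B`. -/
theorem exists_eq_mul_mul {A B Y : H →L[ℂ] H}
    (hA : IsClosed (LinearMap.range (A : H →ₗ[ℂ] H) : Set H))
    (hB : IsClosed (LinearMap.range (B : H →ₗ[ℂ] H) : Set H))
    (hYA : ∀ x, Y x ∈ LinearMap.range (A : H →ₗ[ℂ] H))
    (hYB : ∀ x, B x = 0 → Y x = 0) : ∃ X : H →L[ℂ] H, Y = A * X * B := by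
  obtain ⟨A', hA'⟩ := exists_generalizedInverse A hA
  obtain ⟨B', hB'⟩ := exists_generalizedInverse B hB
  -- B'B moves vectors only within cosets of N(B), where Y is constant, and AA' fixes R(A).
  refine ⟨A' * Y * B', ContinuousLinearMap.ext fun x => ?_⟩
  have h1 : Y (B' (B x)) = Y x := by
    rw [← sub_eq_zero, ← map_sub]
    exact hYB _ (by rw [map_sub, hB', sub_self])
  obtain ⟨a, ha⟩ := hYA x
  have ha' : A a = Y x := ha
  change Y x = A (A' (Y (B' (B x))))
  rw [h1, ← ha', hA']

/-- If `S + N` is closed, some operator with range in `S` and vanishing on `N` is congruent to the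
identity modulo `N` on `S`. -/
theorem exists_obliqueMap {S N : Submodule ℂ H} (hS : IsClosed (S : Set H))
    (hN : IsClosed (N : Set H)) (hSN : IsClosed ((S ⊔ N : Submodule ℂ H) : Set H)) :
    ∃ Y : H →L[ℂ] H, (∀ x, Y x ∈ S) ∧ (∀ x ∈ N, Y x = 0) ∧ ∀ s ∈ S, Y s - s ∈ N := by
  have : CompleteSpace S := hS.completeSpace_coe
  have : CompleteSpace N := hN.completeSpace_coe
  -- The range of C is (S + N) ∩ N^⊥, which is where closedness of S + N enters; on S, equality of
  -- C-values means congruence modulo N.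
  set C : H →L[ℂ] H := (1 - N.starProjection) * S.starProjection with hC
  have hCx : ∀ s ∈ S, C s = s - N.starProjection s := by
    intro s hs
    change S.starProjection s - N.starProjection (S.starProjection s) = _
    rw [Submodule.starProjection_eq_self_iff.2 hs]
  have hrange : LinearMap.range (C : H →ₗ[ℂ] H) = (S ⊔ N) ⊓ Nᗮ := by
    apply le_antisymm
    · rintro _ ⟨x, rfl⟩
      have hs : S.starProjection x ∈ S := Submodule.starProjection_apply_mem S x
      refine ⟨?_, ?_⟩
      · exact Submodule.sub_mem _ (Submodule.mem_sup_left hs)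
          (Submodule.mem_sup_right (Submodule.starProjection_apply_mem N _))
      · exact Submodule.sub_starProjection_mem_orthogonal (K := N) (S.starProjection x)
    · rintro x ⟨hx, hx'⟩
      obtain ⟨s, hs, n, hn, rfl⟩ := Submodule.mem_sup.1 hx
      refine ⟨s, ?_⟩
      have h1 : N.starProjection (s + n) = 0 :=
        (Submodule.starProjection_apply_eq_zero_iff N).2 hx'
      rw [map_add, Submodule.starProjection_eq_self_iff.2 hn] at h1
      change C s = s + n
      rw [hCx s hs, eq_neg_of_add_eq_zero_left h1, sub_neg_eq_add]
  have hCc : IsClosed (LinearMap.range (C : H →ₗ[ℂ] H) : Set H) := by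
    rw [hrange]
    exact hSN.inter (Submodule.isClosed_orthogonal N)
  obtain ⟨C', hC'⟩ := exists_generalizedInverse C hCc
  refine ⟨S.starProjection * C' * (1 - N.starProjection),
    fun x => Submodule.starProjection_apply_mem S _, fun x hx => ?_, fun s hs => ?_⟩
  · change S.starProjection (C' (x - N.starProjection x)) = 0
    rw [Submodule.starProjection_eq_self_iff.2 hx, sub_self, map_zero, map_zero]
  · change S.starProjection (C' (s - N.starProjection s)) - s ∈ N
    rw [← hCx s hs]
    set t := S.starProjection (C' (C s)) with ht
    have htS : t ∈ S := Submodule.starProjection_apply_mem S _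
    have h1 : C t = C s := by
      rw [← hC' s, hC]
      change S.starProjection t - N.starProjection (S.starProjection t) = t - N.starProjection t
      rw [Submodule.starProjection_eq_self_iff.2 htS]
    rw [hCx t htS, hCx s hs] at h1
    have h2 : t - s = N.starProjection (t - s) := by
      rw [map_sub]
      exact sub_eq_sub_iff_sub_eq_sub.1 h1
    rw [h2]
    exact Submodule.starProjection_apply_mem N _

/-! ### Positive operators -/

section Positive

variable {V : H →L[ℂ] H}

/-- The square root of a positive operator as a self-adjoint factor. -/
theorem exists_symmetric_sq (hV : V.IsPositive) :
    ∃ T : H →L[ℂ] H, (∀ x y, inner ℂ (T x) y = inner ℂ x (T y)) ∧ ∀ x, V x = T (T x) := by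
  have hV0 : 0 ≤ V := (ContinuousLinearMap.nonneg_iff_isPositive V).2 hV
  refine ⟨CFC.sqrt V, ((ContinuousLinearMap.nonneg_iff_isPositive _).1
    (CFC.sqrt_nonneg V)).inner_left_eq_inner_right, fun x => ?_⟩
  conv_lhs => rw [← CFC.sqrt_mul_sqrt_self V hV0]
  rfl

theorem eq_zero_of_inner_self_eq_zero (hV : V.IsPositive) {x : H} (hx : inner ℂ (V x) x = 0) :
    V x = 0 := by
  obtain ⟨T, hT, hVT⟩ := exists_symmetric_sq hV
  rw [hVT, hT, inner_self_eq_zero] at hx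
  rw [hVT, hx, map_zero]

/-- A positive operator dominates a rank-one positive operator along each vector of its range. -/
theorem exists_rankOne_le (hV : V.IsPositive) {x : H} (hx : V x ≠ 0) :
    ∃ X : H →L[ℂ] H, 0 ≤ X ∧ X ≤ V ∧ (∀ y, ∃ c : ℂ, X y = c • V x) ∧ X x = V x := by
  obtain ⟨T, hT, hVT⟩ := exists_symmetric_sq hV
  have hu : T x ≠ 0 := fun h => hx (by rw [hVT, h, map_zero])
  -- Inserting the projection onto the line through T x into V = T T gives an operator of rank one
  -- below V that still agrees with V at x.
  set L : Submodule ℂ H := ℂ ∙ T x with hL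
  set P : H →L[ℂ] H := L.starProjection with hP
  have hPP : ∀ y, P (P y) = P y := fun y =>
    Submodule.starProjection_eq_self_iff.2 (Submodule.starProjection_apply_mem L y)
  have key : ∀ y, inner ℂ (T (P (T y))) y = ((‖P (T y)‖ ^ 2 : ℝ) : ℂ) := by
    intro y
    rw [hT, ← hPP, Submodule.inner_starProjection_left_eq_right L, inner_self_eq_norm_sq_to_K, hPP]
    simp
  have keyV : ∀ y, inner ℂ (V y) y = ((‖T y‖ ^ 2 : ℝ) : ℂ) := by
    intro y
    rw [hVT, hT, inner_self_eq_norm_sq_to_K]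
    simp
  refine ⟨T * P * T, ?_, ?_, fun y => ?_, ?_⟩
  · rw [ContinuousLinearMap.nonneg_iff_isPositive, ContinuousLinearMap.isPositive_iff_complex]
    intro y
    have h : inner ℂ ((T * P * T) y) y = ((‖P (T y)‖ ^ 2 : ℝ) : ℂ) := key y
    rw [h, RCLike.re_eq_complex_re, Complex.ofReal_re]
    exact ⟨rfl, by positivity⟩
  · rw [ContinuousLinearMap.le_def, ContinuousLinearMap.isPositive_iff_complex]
    intro y
    have h : inner ℂ ((V - T * P * T) y) y = ((‖T y‖ ^ 2 - ‖P (T y)‖ ^ 2 : ℝ) : ℂ) := by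
      change inner ℂ (V y - T (P (T y))) y = _
      rw [inner_sub_left, key, keyV]
      push_cast
      rfl
    rw [h, RCLike.re_eq_complex_re, Complex.ofReal_re]
    refine ⟨rfl, sub_nonneg.2 ?_⟩
    gcongr
    exact Submodule.norm_starProjection_apply_le L (T y)
  · obtain ⟨c, hc⟩ := Submodule.mem_span_singleton.1 (Submodule.starProjection_apply_mem L (T y))
    refine ⟨c, ?_⟩
    change T (P (T y)) = _
    rw [hP, ← hc, map_smul, hVT]
  · change T (P (T x)) = _
    rw [hP, Submodule.starProjection_eq_self_iff.2 (Submodule.mem_span_singleton_self _), hVT]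

end Positive

/-! ### The shorted operator and compatibility -/

section Shorted

variable {W : H →L[ℂ] H} (hW : W.IsPositive) (S : Submodule ℂ H)

theorem shorted_isPositive : (shorted W hW S).IsPositive :=
  (ContinuousLinearMap.nonneg_iff_isPositive _).1 (shorted_isGreatest W hW S).1.1

theorem sub_shorted_isPositive : (W - shorted W hW S).IsPositive :=
  (ContinuousLinearMap.le_def _ _).1 (shorted_isGreatest W hW S).1.2.1

theorem inner_shorted_eq_zero (x : H) {s : H} (hs : s ∈ S) :
    inner ℂ (shorted W hW S x) s = 0 :=
  (Submodule.mem_orthogonal' S _).1 ((shorted_isGreatest W hW S).1.2.2 ⟨x, rfl⟩) s hs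

theorem shorted_apply_of_mem {s : H} (hs : s ∈ S) : shorted W hW S s = 0 :=
  eq_zero_of_inner_self_eq_zero (shorted_isPositive hW S) (inner_shorted_eq_zero hW S s hs)

/-- Maximality gives the harder direction: if W x ⊥ S and (W - G) x ≠ 0, then (W - G) x lies in S^⊥,
and a rank-one operator below W - G with range along it could be added to G. -/
theorem shorted_apply_eq_iff {x : H} : shorted W hW S x = W x ↔ x ∈ wOrth W S := by
  constructor
  · intro h s hs
    rw [← h]
    exact inner_shorted_eq_zero hW S x hs
  · intro hx
    by_contra hne
    have hV := sub_shorted_isPositive hW S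
    set G := shorted W hW S with hG
    have hVx : (W - G) x ≠ 0 := fun h => hne (sub_eq_zero.1 h).symm
    obtain ⟨X, hX0, hXV, hXr, hXx⟩ := exists_rankOne_le hV hVx
    have hmem : G + X ∈ shortedSet W S := by
      refine ⟨add_nonneg (shorted_isGreatest W hW S).1.1 hX0, ?_, ?_⟩
      · have := add_le_add_right hXV G
        simpa using this
      · rintro _ ⟨y, rfl⟩
        rw [Submodule.mem_orthogonal']
        intro s hs
        obtain ⟨c, hc⟩ := hXr y
        change inner ℂ (G y + X y) s = 0
        rw [hc, inner_add_left, inner_shorted_eq_zero hW S y hs, inner_smul_left]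
        change 0 + _ * inner ℂ (W x - G x) s = 0
        rw [inner_sub_left, inner_shorted_eq_zero hW S x hs, hx s hs]
        simp
    have hle : G + X ≤ G := (shorted_isGreatest W hW S).2 hmem
    have hX : X = 0 := le_antisymm (by simpa using hle) hX0
    exact hVx (by rw [← hXx, hX]; rfl)

theorem inner_eq_zero_of_mem_wOrth_of_mem_ker {x y : H} (hx : x ∈ wOrth W S)
    (hy : shorted W hW S y = 0) : inner ℂ (W x) y = 0 := by
  rw [← (shorted_apply_eq_iff hW S).2 hx,
    (shorted_isPositive hW S).inner_left_eq_inner_right, hy, inner_zero_right]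

/-- The pair `(W, N(W_{/S}))` is compatible iff there is a projection onto `N(W_{/S})` whose
nullspace is `W`-orthogonal to `S`. -/
theorem compatible_ker_shorted_iff :
    Compatible W (LinearMap.ker (shorted W hW S : H →ₗ[ℂ] H)) ↔
      ∃ Q : H →L[ℂ] H, IsIdempotentElem Q ∧ (∀ x, shorted W hW S (Q x) = 0) ∧
        (∀ x, shorted W hW S x = 0 → Q x = x) ∧ ∀ x, x - Q x ∈ wOrth W S := by
  constructor
  · rintro ⟨Q, hQ, hQr, hWQ⟩
    have hQQ : ∀ x, Q (Q x) = Q x := fun x => congrArg (fun T : H →L[ℂ] H => T x) hQ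
    have hfix : ∀ x, shorted W hW S x = 0 → Q x = x := by
      intro x hx
      have : x ∈ LinearMap.range (Q : H →ₗ[ℂ] H) := by rw [hQr]; exact hx
      obtain ⟨y, rfl⟩ := this
      exact hQQ y
    refine ⟨Q, hQ, fun x => ?_, hfix, fun x s hs => ?_⟩
    · have : Q x ∈ LinearMap.ker (shorted W hW S : H →ₗ[ℂ] H) := by rw [← hQr]; exact ⟨x, rfl⟩
      exact this
    · have h1 : W (Q (x - Q x)) = adjoint Q (W (x - Q x)) :=
        congrArg (fun T : H →L[ℂ] H => T (x - Q x)) hWQ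
      rw [← hfix s (shorted_apply_of_mem hW S hs), ← adjoint_inner_left, ← h1, map_sub, hQQ,
        sub_self, map_zero, inner_zero_left]
  · rintro ⟨Q, hQ, hQk, hfix, hQN⟩
    -- With these cross terms zero, both sides of WQ = Q*W have the same form ⟨W Q x, Q y⟩.
    have hinner : ∀ x y, inner ℂ (W (x - Q x)) (Q y) = 0 := fun x y =>
      inner_eq_zero_of_mem_wOrth_of_mem_ker hW S (hQN x) (hQk y)
    refine ⟨Q, hQ, ?_, ?_⟩
    · ext x
      exact ⟨fun ⟨y, hy⟩ => hy ▸ hQk y, fun hx => ⟨x, hfix x hx⟩⟩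
    · ext x
      refine ext_inner_right ℂ fun y => ?_
      change inner ℂ (W (Q x)) y = inner ℂ (adjoint Q (W x)) y
      have h1 := hinner x y
      have h2 := hinner y x
      rw [map_sub, inner_sub_left, sub_eq_zero] at h1 h2
      rw [adjoint_inner_left, h1, hW.inner_left_eq_inner_right (Q x) y,
        hW.inner_left_eq_inner_right (Q x) (Q y), ← inner_conj_symm, h2, inner_conj_symm]

end Shorted

/-! ### Lower bounds in the minus order -/

/-- Between self-adjoint operators the minus order needs a single projection. -/
theorem minusLE_of_isSelfAdjoint {C D P : H →L[ℂ] H} (hC : adjoint C = C) (hD : adjoint D = D)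
    (hP : IsIdempotentElem P) (h : C = P * D) : MinusLE C D :=
  ⟨P, P, hP, hP, h, by rw [hC, hD, ← h]⟩

theorem isIdempotentElem_one_sub_adjoint {P : H →L[ℂ] H} (hP : IsIdempotentElem P) :
    IsIdempotentElem (1 - adjoint P) := by
  apply IsIdempotentElem.one_sub
  have := congrArg adjoint hP
  rwa [mul_def, adjoint_comp] at this

section Family

variable {W : H →L[ℂ] H} (hW : W.IsPositive) (S : Submodule ℂ H)

theorem compatible_of_minusLE (h : MinusLE (shorted W hW S) W) :
    Compatible W (LinearMap.ker (shorted W hW S : H →ₗ[ℂ] H)) := by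
  obtain ⟨P, -, hP, -, hPW, -⟩ := h
  rw [compatible_ker_shorted_iff hW S]
  set G := shorted W hW S with hG
  have hGsa : adjoint G = G := (shorted_isPositive hW S).isSelfAdjoint
  have hWsa : adjoint W = W := hW.isSelfAdjoint
  have hGW : ∀ x, G x = W (adjoint P x) := by
    intro x
    have := congrArg adjoint hPW
    rw [mul_def, adjoint_comp, hGsa, hWsa] at this
    exact congrArg (fun T : H →L[ℂ] H => T x) this
  set E : H →L[ℂ] H := adjoint P with hE
  have hEE : ∀ x, E (E x) = E x := by
    intro x
    have := congrArg adjoint hP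
    rw [mul_def, adjoint_comp] at this
    exact congrArg (fun T : H →L[ℂ] H => T x) this
  have hPG : P * G = G := by rw [hPW, ← mul_assoc, hP.eq]
  have hGE : ∀ x, G (E x) = G x := by
    intro x
    have := congrArg adjoint hPG
    rw [mul_def, adjoint_comp, hGsa] at this
    exact congrArg (fun T : H →L[ℂ] H => T x) this
  -- G and W both send E x to G x, so they agree there.
  have hEN : ∀ x, E x ∈ wOrth W S := fun x =>
    (shorted_apply_eq_iff hW S).1 (by rw [← hG, hGE, hGW])
  set K : Submodule ℂ H :=
    LinearMap.ker ((1 - E : H →L[ℂ] H) : H →ₗ[ℂ] H) ⊓ LinearMap.ker (G : H →ₗ[ℂ] H) with hK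
  have hKc : IsClosed (K : Set H) :=
    (ContinuousLinearMap.isClosed_ker (1 - E)).inter (ContinuousLinearMap.isClosed_ker G)
  have : CompleteSpace K := hKc.completeSpace_coe
  set p : H →L[ℂ] H := K.starProjection with hp
  have hpK : ∀ x, p x ∈ K := fun x => Submodule.starProjection_apply_mem K x
  have hpE : ∀ x, E (p x) = p x := fun x => by
    have h1 : p x - E (p x) = 0 := (hpK x).1
    exact (sub_eq_zero.1 h1).symm
  have hpG : ∀ x, G (p x) = 0 := fun x => (hpK x).2
  have hpid : ∀ x ∈ K, p x = x := fun x hx => Submodule.starProjection_eq_self_iff.2 hx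
  -- N(G) is the direct sum of N(E) and K = R(E) ∩ N(G): 1 - E projects onto the first summand, and
  -- p * E supplies the second. The complement x - Q x stays in R(E), hence in N.
  refine ⟨1 - E + p * E, ?_, fun x => ?_, fun x hx => ?_, fun x => ?_⟩
  · ext x
    change (x - E x + p (E x)) - E (x - E x + p (E x)) + p (E (x - E x + p (E x)))
      = x - E x + p (E x)
    have : E (x - E x + p (E x)) = p (E x) := by
      rw [map_add, map_sub, hEE, hpE, sub_self, zero_add]
    rw [this, hpid _ (hpK _)]
    abel
  · change G (x - E x + p (E x)) = 0
    rw [map_add, map_sub, hGE, hpG, sub_self, add_zero]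
  · change x - E x + p (E x) = x
    rw [hpid (E x) ⟨?_, ?_⟩]
    · abel
    · change E x - E (E x) = 0
      rw [hEE, sub_self]
    · change G (E x) = 0
      rw [hGE, hx]
  · change x - (x - E x + p (E x)) ∈ wOrth W S
    have : x - (x - E x + p (E x)) = E (x - p (E x)) := by
      rw [map_sub, hpE]
      abel
    rw [this]
    exact hEN _

/-- If `R(Y) ⊆ S` and `Y` vanishes on the `W`-orthogonal companion of `S`, the shorted operator
lies below `(Y - 1)* W (Y - 1)` whenever `(W, N(W_{/S}))` is compatible. -/
theorem shorted_minusLE_of_compatible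
    (h : Compatible W (LinearMap.ker (shorted W hW S : H →ₗ[ℂ] H)))
    {Y : H →L[ℂ] H} (hYS : ∀ x, Y x ∈ S) (hYN : ∀ x ∈ wOrth W S, Y x = 0) :
    MinusLE (shorted W hW S) (adjoint (Y - 1) * W * (Y - 1)) := by
  obtain ⟨Q, hQ, hQk, -, hQN⟩ := (compatible_ker_shorted_iff hW S).1 h
  set G := shorted W hW S with hG
  have hGsa : adjoint G = G := (shorted_isPositive hW S).isSelfAdjoint
  have hWsa : adjoint W = W := hW.isSelfAdjoint
  set Z := adjoint (Y - 1) * W * (Y - 1) with hZ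
  have hZsa : adjoint Z = Z := by
    rw [hZ, mul_def, mul_def, adjoint_comp, adjoint_comp, adjoint_adjoint, hWsa, comp_assoc]
  have hZN : ∀ x ∈ wOrth W S, Z x = G x := by
    intro x hx
    refine ext_inner_right ℂ fun y => ?_
    change inner ℂ (adjoint (Y - 1) (W (Y x - x))) y = _
    rw [adjoint_inner_left, hYN x hx, zero_sub, map_neg]
    change inner ℂ (-W x) (Y y - y) = _
    rw [inner_sub_right, inner_neg_left, inner_neg_left, hx (Y y) (hYS y),
      (shorted_apply_eq_iff hW S).2 hx]
    simp
  refine minusLE_of_isSelfAdjoint hGsa hZsa (isIdempotentElem_one_sub_adjoint hQ) ?_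
  have h1 : G = Z * (1 - Q) := by
    ext x
    change G x = Z (x - Q x)
    rw [hZN _ (hQN x), map_sub, hQk, sub_zero]
  have h2 := congrArg adjoint h1
  rw [mul_def, adjoint_comp, hGsa, hZsa] at h2
  rw [h2]
  congr 1
  rw [map_sub, one_def, adjoint_id]

/-- If `D = P W` vanishes on `S` and `R(D*) ⊆ R(W)`, then also `D = P W_{/S}`. -/
theorem eq_mul_shorted_of_eq_mul
    (h : Compatible W (LinearMap.ker (shorted W hW S : H →ₗ[ℂ] H)))
    {D P : H →L[ℂ] H} (hD : D = P * W) (hDr : ∀ x, ∃ y, adjoint D x = W y)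
    (hDS : ∀ s ∈ S, D s = 0) : D = P * shorted W hW S := by
  obtain ⟨Q, hQ, hQk, -, hQN⟩ := (compatible_ker_shorted_iff hW S).1 h
  -- If D* x = W y, then D = 0 on S forces y ∈ N, so W y = G y is orthogonal to N(G).
  have hDk : ∀ z, shorted W hW S z = 0 → D z = 0 := by
    intro z hz
    refine ext_inner_left ℂ fun x => ?_
    obtain ⟨y, hy⟩ := hDr x
    rw [← adjoint_inner_left, hy, inner_zero_right]
    refine inner_eq_zero_of_mem_wOrth_of_mem_ker hW S (fun s hs => ?_) hz
    rw [← hy, adjoint_inner_left, hDS s hs, inner_zero_right]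
  ext x
  have h1 : D x = D (x - Q x) := by rw [map_sub, hDk _ (hQk x), sub_zero]
  have h2 : shorted W hW S x = W (x - Q x) := by
    rw [← (shorted_apply_eq_iff hW S).2 (hQN x), map_sub, hQk, sub_zero]
  rw [h1, hD]
  change P (W (x - Q x)) = P (shorted W hW S x)
  rw [h2]

/-- An operator below both `W` and `(Y - 1)* W (Y - 1)`, with `Y` as in `exists_obliqueMap`, lies
below the shorted operator. -/
theorem minusLE_shorted
    (h : Compatible W (LinearMap.ker (shorted W hW S : H →ₗ[ℂ] H)))
    {Y D : H →L[ℂ] H} (hYr : ∀ x, Y x ∈ S)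
    (hYS : ∀ s ∈ S, Y s - s ∈ wOrth W S)
    (hDW : MinusLE D W) (hDZ : MinusLE D (adjoint (Y - 1) * W * (Y - 1))) :
    MinusLE D (shorted W hW S) := by
  have hGsa : adjoint (shorted W hW S) = shorted W hW S := (shorted_isPositive hW S).isSelfAdjoint
  have hWsa : adjoint W = W := hW.isSelfAdjoint
  obtain ⟨P, Q, hP, hQ, hDP, hDQ⟩ := hDW
  obtain ⟨P', Q', -, -, hDP', hDQ'⟩ := hDZ
  set Z := adjoint (Y - 1) * W * (Y - 1) with hZ
  have hZsa : adjoint Z = Z := by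
    rw [hZ, mul_def, mul_def, adjoint_comp, adjoint_comp, adjoint_adjoint, hWsa, comp_assoc]
  rw [hWsa] at hDQ
  rw [hZsa] at hDQ'
  have hZS : ∀ s ∈ S, Z s = 0 := by
    intro s hs
    have h1 : W (Y s - s) = 0 := by
      rw [← (shorted_apply_eq_iff hW S).2 (hYS s hs), map_sub,
        shorted_apply_of_mem hW S (hYr s), shorted_apply_of_mem hW S hs, sub_zero]
    change adjoint (Y - 1) (W (Y s - s)) = 0
    rw [h1, map_zero]
  have hDr : ∀ x, adjoint D x = W (adjoint P x) := by
    intro x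
    have := congrArg adjoint hDP
    rw [mul_def, adjoint_comp, hWsa] at this
    exact congrArg (fun T : H →L[ℂ] H => T x) this
  have hDr' : ∀ x, adjoint (adjoint D) x = W (adjoint Q x) := by
    intro x
    have := congrArg adjoint hDQ
    rw [mul_def, adjoint_comp, hWsa] at this
    exact congrArg (fun T : H →L[ℂ] H => T x) this
  refine ⟨P, Q, hP, hQ, ?_, ?_⟩
  · refine eq_mul_shorted_of_eq_mul hW S h hDP (fun x => ⟨_, hDr x⟩) fun s hs => ?_
    rw [hDP']
    change P' (Z s) = 0
    rw [hZS s hs, map_zero]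
  · rw [hGsa]
    refine eq_mul_shorted_of_eq_mul hW S h hDQ (fun x => ⟨_, hDr' x⟩) fun s hs => ?_
    rw [hDQ']
    change Q' (Z s) = 0
    rw [hZS s hs, map_zero]

end Family

end MinusOrder

theorem mainTheorem2 {H : Type*} [NormedAddCommGroup H] [InnerProductSpace ℂ H] [CompleteSpace H]
    (A B W : H →L[ℂ] H)
    (hA : IsClosed (LinearMap.range (A : H →ₗ[ℂ] H) : Set H))
    (hB : IsClosed (LinearMap.range (B : H →ₗ[ℂ] H) : Set H))
    (hW : W.IsPositive)
    (hAB : LinearMap.ker (B : H →ₗ[ℂ] H)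
      = MinusOrder.wOrth W (LinearMap.range (A : H →ₗ[ℂ] H))) :
    (MinusOrder.IsMinusLowerBound
        (Set.range fun X : H →L[ℂ] H =>
          ContinuousLinearMap.adjoint (A * X * B - 1) * W * (A * X * B - 1))
        (MinusOrder.shorted W hW (LinearMap.range (A : H →ₗ[ℂ] H)))
      ↔ MinusOrder.Compatible W (LinearMap.ker
          (MinusOrder.shorted W hW (LinearMap.range (A : H →ₗ[ℂ] H)) : H →ₗ[ℂ] H))) ∧
    (MinusOrder.Compatible W (LinearMap.ker
          (MinusOrder.shorted W hW (LinearMap.range (A : H →ₗ[ℂ] H)) : H →ₗ[ℂ] H)) →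
      IsClosed ((LinearMap.range (A : H →ₗ[ℂ] H)
          ⊔ MinusOrder.wOrth W (LinearMap.range (A : H →ₗ[ℂ] H)) : Submodule ℂ H) : Set H) →
      MinusOrder.IsMinusInf
        (Set.range fun X : H →L[ℂ] H =>
          ContinuousLinearMap.adjoint (A * X * B - 1) * W * (A * X * B - 1))
        (MinusOrder.shorted W hW (LinearMap.range (A : H →ₗ[ℂ] H)))) := by
  set S := LinearMap.range (A : H →ₗ[ℂ] H) with hS
  have hBN : ∀ x, B x = 0 ↔ x ∈ MinusOrder.wOrth W S := fun x => by
    rw [← hAB]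
    rfl
  have hW0 : ContinuousLinearMap.adjoint (A * 0 * B - 1) * W * (A * 0 * B - 1) = W := by
    rw [mul_zero, zero_mul, zero_sub, map_neg, ContinuousLinearMap.one_def,
      ContinuousLinearMap.adjoint_id, ← ContinuousLinearMap.one_def]
    simp
  have hlower : MinusOrder.Compatible W (LinearMap.ker
      (MinusOrder.shorted W hW S : H →ₗ[ℂ] H)) →
      MinusOrder.IsMinusLowerBound
        (Set.range fun X : H →L[ℂ] H =>
          ContinuousLinearMap.adjoint (A * X * B - 1) * W * (A * X * B - 1))
        (MinusOrder.shorted W hW S) := by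
    rintro h _ ⟨X, rfl⟩
    refine MinusOrder.shorted_minusLE_of_compatible hW S h (fun x => ⟨X (B x), rfl⟩)
      fun x hx => ?_
    change A (X (B x)) = 0
    rw [(hBN x).2 hx, map_zero, map_zero]
  refine ⟨⟨fun h => ?_, hlower⟩, fun h hcl => ⟨hlower h, fun D hD => ?_⟩⟩
  -- X = 0 yields W itself.
  · have h0 := h _ ⟨0, rfl⟩
    simp only [hW0] at h0
    exact MinusOrder.compatible_of_minusLE hW S h0
  · have hDW := hD _ ⟨0, rfl⟩
    simp only [hW0] at hDW
    obtain ⟨Y, hYr, hYN, hYS⟩ :=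
      MinusOrder.exists_obliqueMap hA (MinusOrder.isClosed_wOrth W S) hcl
    obtain ⟨X, hX⟩ := MinusOrder.exists_eq_mul_mul hA hB hYr fun x hx => hYN x ((hBN x).1 hx)
    have hDY := hD _ ⟨X, rfl⟩
    simp only [← hX] at hDY
    exact MinusOrder.minusLE_shorted hW S h hYr hYS hDW hDY
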